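/- A function $f$ is called completely monotonic on an interval $I$ if it has derivatives of all orders on $I$ and $(-1)^n f^{(n)}(x)\ge 0$ for all $x\in I$ and all integers $n\ge 0$. Let $\psi(x)=\Gamma'(x)/\Gamma(x)$ be the digamma function, where $\Gamma$ is Euler's gamma function, and let $\lambda\in\mathbb{R}$. Then the function $$ x\mapsto \psi'(x)-\frac{\lambda\,(4+8x+5x^2)}{24x(1+x)^3(2+x)^2}-\frac{24+120x+283x^2+399x^3+345x^4+181x^5+51x^6+6x^7}{6x^2(1+x)^4(2+x)^2} $$ is completely monotonic on $(0,\infty)$ if and only if $\lambda\le 0$, and its negative is completely monotonic on $(0,\infty)$ if and only if $\lambda\ge 4$. -/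

import Mathlib

open scoped ContDiff

/-- `f` is completely monotonic on the (nondegenerate) interval `I`: it has derivatives of all
orders on `I`, and `0 ≤ (-1) ^ n * f⁽ⁿ⁾(x)` for every `x ∈ I` and every `n ≥ 0`. -/
def CompletelyMonotonicOn (f : ℝ → ℝ) (I : Set ℝ) : Prop :=
  ContDiffOn ℝ ∞ f I ∧ ∀ n : ℕ, ∀ x ∈ I, 0 ≤ (-1 : ℝ) ^ n * iteratedDerivWithin n f I x

/-- The psi (digamma) function `ψ(x) = Γ'(x) / Γ(x)` of a real variable. -/
noncomputable def psi (x : ℝ) : ℝ := deriv Real.Gamma x / Real.Gamma x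

/-- The function
`ψ'(x) - λ (4 + 8x + 5x²) / (24 x (1+x)³ (2+x)²) - (24 + ⋯ + 6x⁷) / (6 x² (1+x)⁴ (2+x)²)`. -/
noncomputable def trigammaDiff (lam : ℝ) (x : ℝ) : ℝ :=
  deriv psi x
    - lam * (4 + 8 * x + 5 * x ^ 2) / (24 * x * (1 + x) ^ 3 * (2 + x) ^ 2)
    - (24 + 120 * x + 283 * x ^ 2 + 399 * x ^ 3 + 345 * x ^ 4 + 181 * x ^ 5 + 51 * x ^ 6
        + 6 * x ^ 7) / (6 * x ^ 2 * (1 + x) ^ 4 * (2 + x) ^ 2)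

open Set Filter Topology

/-! Write F_λ for `trigammaDiff lam`. Since ψ'(x) - ψ'(x+1) = 1/x², the difference F_λ(x) - F_λ(x+1)
is rational, and F_λ vanishes along x + ℕ. By `CompletelyMonotonicOn.of_sub_shift`, complete
monotonicity then passes from the difference to the function. For F_0 and -F_4 the difference is a
nonnegative combination of products of inverse powers of x, x+1, x+2, x+3. Every other admissible λ
adds a nonnegative multiple of a completely monotonic weight. Necessity uses only the sign of F_λ:
at 0 the weight blows up while F_0 stays bounded above; at infinity the difference has leading
numerator term 20(4 - λ)x⁶. -/

/-! ### Reduction to unit differences -/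

/-- An antitone-difference criterion for decay: if `-h` is the derivative of a function whose
increments along `x + ℕ` vanish, and `x ↦ h x - h (x + 1)` is antitone, then `h` vanishes
along `x + ℕ`. -/
theorem tendsto_add_nat_zero_of_antitoneOn_sub {H h : ℝ → ℝ}
    (hd : ∀ x, 0 < x → HasDerivAt H (-h x) x) (hc : ContinuousOn h (Ioi 0))
    (hH : ∀ x, 0 < x → ∀ δ, 0 < δ → δ ≤ 1 →
      Tendsto (fun n : ℕ => H (x + δ + n) - H (x + n)) atTop (𝓝 0))
    (hg : AntitoneOn (fun x => h x - h (x + 1)) (Ioi 0)) (x : ℝ) (hx : 0 < x) :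
    Tendsto (fun n : ℕ => h (x + n)) atTop (𝓝 0) := by
  have key : ∀ n : ℕ, ∀ y z : ℝ, 0 < y → y ≤ z → h z - h (z + n) ≤ h y - h (y + n) := by
    intro n y z hy hyz
    induction n with
    | zero => simp
    | succ n ih =>
      have h1 := hg (a := y + n) (b := z + n) (by simp only [mem_Ioi]; positivity)
        (by simp only [mem_Ioi]; have := hy.trans_le hyz; positivity) (by linarith)
      simp only at h1
      push_cast
      rw [← add_assoc, ← add_assoc]
      linarith
  have mvt : ∀ a δ : ℝ, 0 < a → 0 < δ → ∀ n : ℕ, ∃ y ∈ Ioo a (a + δ),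
      h (y + n) = -(H (a + δ + n) - H (a + n)) / δ := by
    intro a δ ha hδ n
    have hn : (0 : ℝ) ≤ n := n.cast_nonneg
    obtain ⟨c, hc, hc'⟩ := exists_hasDerivAt_eq_slope H (fun t => -h t)
      (a := a + n) (b := a + δ + n) (by linarith)
      (fun t ht => (hd t (by linarith [ht.1])).continuousAt.continuousWithinAt)
      (fun t ht => hd t (by linarith [ht.1]))
    refine ⟨c - n, ⟨by linarith [hc.1], by linarith [hc.2]⟩, ?_⟩
    have : a + δ + n - (a + n) = δ := by ring
    rw [this] at hc'
    rw [sub_add_cancel, neg_div, ← hc', neg_neg]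
  rw [Metric.tendsto_atTop']
  intro ε hε
  have hcx : ContinuousAt h x := hc.continuousAt (Ioi_mem_nhds hx)
  obtain ⟨r, hr, hr'⟩ := Metric.continuousAt_iff.1 hcx (ε / 2) (by positivity)
  obtain ⟨δ, hδ, hδr, hδx, hδ1⟩ : ∃ δ : ℝ, 0 < δ ∧ δ ≤ r ∧ δ < x ∧ δ ≤ 1 :=
    ⟨min (min r (x / 2)) 1, by positivity, (min_le_left _ _).trans (min_le_left _ _),
      ((min_le_left _ _).trans (min_le_right _ _)).trans_lt (by linarith), min_le_right _ _⟩
  have e1 := (Metric.tendsto_atTop.1 (hH x hx δ hδ hδ1)) (δ * (ε / 2)) (by positivity)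
  have e2 := (Metric.tendsto_atTop.1 (hH (x - δ) (by linarith) δ hδ hδ1)) (δ * (ε / 2))
    (by positivity)
  obtain ⟨N1, h1⟩ := e1
  obtain ⟨N2, h2⟩ := e2
  refine ⟨max N1 N2, fun n hn => ?_⟩
  have b1 := h1 n ((le_max_left _ _).trans hn.le)
  have b2 := h2 n ((le_max_right _ _).trans hn.le)
  rw [Real.dist_eq, sub_zero, abs_lt] at b1 b2 ⊢
  -- Mean value points on either side of x trap h(x+n): by `key`, h x - h z ≤ h(x+n) - h(z+n) and
  -- h(x+n) - h(y+n) ≤ h x - h y.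
  obtain ⟨y, hy, hy'⟩ := mvt x δ hx hδ n
  obtain ⟨z, hz, hz'⟩ := mvt (x - δ) δ (by linarith) hδ n
  have k1 := key n x y hx hy.1.le
  have k2 := key n z x (by linarith [hz.1]) (by linarith [hz.2])
  have c1 := @hr' y (by rw [Real.dist_eq, abs_lt]; constructor <;> linarith [hy.1, hy.2])
  have c2 := @hr' z (by rw [Real.dist_eq, abs_lt]; constructor <;> linarith [hz.1, hz.2])
  rw [Real.dist_eq, abs_lt] at c1 c2
  have d1 : h (y + n) < ε / 2 := by
    rw [hy', div_lt_iff₀ hδ]; linarith [b1.1]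
  have d2 : -(ε / 2) < h (z + n) := by
    rw [hz', lt_div_iff₀ hδ]; linarith [b2.2]
  constructor <;> linarith

theorem hasDerivAt_iteratedDerivWithin_Ioi {f : ℝ → ℝ} (hf : ContDiffOn ℝ ∞ f (Ioi 0)) (n : ℕ)
    {x : ℝ} (hx : 0 < x) :
    HasDerivAt (iteratedDerivWithin n f (Ioi 0)) (iteratedDerivWithin (n + 1) f (Ioi 0) x) x := by
  have h := hf.differentiableOn_iteratedDerivWithin (m := n) (by exact_mod_cast ENat.natCast_lt_top n)
    (uniqueDiffOn_Ioi 0)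
  rw [iteratedDerivWithin_succ]
  exact (h x hx).hasDerivWithinAt.hasDerivAt (Ioi_mem_nhds hx)

theorem iteratedDerivWithin_Ioi_sub_shift {f : ℝ → ℝ} (hf : ContDiffOn ℝ ∞ f (Ioi 0)) (n : ℕ) :
    ∀ x, 0 < x → iteratedDerivWithin n (fun x => f x - f (x + 1)) (Ioi 0) x =
      iteratedDerivWithin n f (Ioi 0) x - iteratedDerivWithin n f (Ioi 0) (x + 1) := by
  induction n with
  | zero => simp
  | succ n ih =>
    intro x hx
    have h1 := hasDerivAt_iteratedDerivWithin_Ioi hf n hx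
    have h2 := (hasDerivAt_iteratedDerivWithin_Ioi hf n (x := x + 1) (by linarith)).comp_add_const
      x 1
    rw [iteratedDerivWithin_succ, derivWithin_of_isOpen isOpen_Ioi hx]
    refine ((h1.sub h2).congr_of_eventuallyEq ?_).deriv
    filter_upwards [Ioi_mem_nhds hx] with y hy using ih y hy

theorem nonneg_of_sub_shift_nonneg {f : ℝ → ℝ} {x : ℝ}
    (h0 : Tendsto (fun n : ℕ => f (x + n)) atTop (𝓝 0))
    (h : ∀ n : ℕ, 0 ≤ f (x + n) - f (x + n + 1)) : 0 ≤ f x := by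
  have ha : Antitone (fun n : ℕ => f (x + n)) := antitone_nat_of_succ_le fun n => by
    have := h n
    push_cast
    rw [← add_assoc]
    linarith
  simpa using ha.le_of_tendsto h0 0

/-- A smooth function that vanishes along `x + ℕ` is completely monotonic as soon as
`x ↦ f x - f (x + 1)` is. -/
theorem CompletelyMonotonicOn.of_sub_shift {f : ℝ → ℝ} (hf : ContDiffOn ℝ ∞ f (Ioi 0))
    (h0 : ∀ x, 0 < x → Tendsto (fun n : ℕ => f (x + n)) atTop (𝓝 0))
    (hg : CompletelyMonotonicOn (fun x => f x - f (x + 1)) (Ioi 0)) :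
    CompletelyMonotonicOn f (Ioi 0) := by
  obtain ⟨h, hh⟩ : ∃ h : ℕ → ℝ → ℝ,
      ∀ n x, h n x = (-1) ^ n * iteratedDerivWithin n f (Ioi 0) x := ⟨_, fun _ _ => rfl⟩
  have hd : ∀ n x, 0 < x → HasDerivAt (h n) (-h (n + 1) x) x := by
    intro n x hx
    have := (hasDerivAt_iteratedDerivWithin_Ioi hf n hx).const_mul ((-1 : ℝ) ^ n)
    rw [← funext (hh n)] at this
    refine this.congr_deriv ?_
    rw [hh]
    ring
  have hs : ∀ n x, 0 < x → h n x - h n (x + 1) =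
      (-1) ^ n * iteratedDerivWithin n (fun x => f x - f (x + 1)) (Ioi 0) x := by
    intro n x hx
    rw [iteratedDerivWithin_Ioi_sub_shift hf n x hx]
    simp only [hh]; ring
  have hs0 : ∀ n x, 0 < x → 0 ≤ h n x - h n (x + 1) := by
    intro n x hx
    rw [hs n x hx]
    exact hg.2 n x hx
  have hanti : ∀ n, AntitoneOn (fun x => h n x - h n (x + 1)) (Ioi 0) := by
    intro n
    have hD : ∀ x, 0 < x → HasDerivAt (fun x => h n x - h n (x + 1))
        (-h (n + 1) x - -h (n + 1) (x + 1)) x := fun x hx =>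
      (hd n x hx).sub ((hd n (x + 1) (by linarith)).comp_add_const x 1)
    refine antitoneOn_of_deriv_nonpos (convex_Ioi 0)
      (fun x hx => (hD x hx).continuousAt.continuousWithinAt) ?_ ?_
    · rw [interior_Ioi]
      exact fun x hx => (hD x hx).differentiableAt.differentiableWithinAt
    · rw [interior_Ioi]
      intro x hx
      rw [(hD x hx).deriv]
      linarith [hs0 (n + 1) x hx]
  -- Decay passes to each derivative: if `h n` vanishes along every x + ℕ, so do its increments, and
  -- the criterion applies to `h (n + 1)`.
  have ht : ∀ n x, 0 < x → Tendsto (fun k : ℕ => h n (x + k)) atTop (𝓝 0) := by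
    intro n
    induction n with
    | zero => simpa [hh] using h0
    | succ n ih =>
      refine tendsto_add_nat_zero_of_antitoneOn_sub (hd n)
        (fun x hx => (hd (n + 1) x hx).continuousAt.continuousWithinAt) ?_ (hanti (n + 1))
      intro x hx δ hδ _
      simpa using (ih (x + δ) (by linarith)).sub (ih x hx)
  refine ⟨hf, fun n x hx => ?_⟩
  rw [← hh]
  refine nonneg_of_sub_shift_nonneg (ht n x hx) fun k => hs0 n (x + k) ?_
  have : 0 < x := hx
  positivity

/-! ### Closure properties and basic examples -/

theorem CompletelyMonotonicOn.congr {f g : ℝ → ℝ} (hf : CompletelyMonotonicOn f (Ioi 0))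
    (h : ∀ x, 0 < x → g x = f x) : CompletelyMonotonicOn g (Ioi 0) := by
  refine ⟨hf.1.congr h, fun n x hx => ?_⟩
  rw [iteratedDerivWithin_congr (s := Ioi 0) (g := f) h hx]
  exact hf.2 n x hx

theorem CompletelyMonotonicOn.add {f g : ℝ → ℝ} (hf : CompletelyMonotonicOn f (Ioi 0))
    (hg : CompletelyMonotonicOn g (Ioi 0)) :
    CompletelyMonotonicOn (fun x => f x + g x) (Ioi 0) := by
  refine ⟨hf.1.add hg.1, fun n x hx => ?_⟩
  have := iteratedDerivWithin_fun_add (n := n) hx (uniqueDiffOn_Ioi 0)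
    ((hf.1 x hx).of_le (by exact_mod_cast le_top)) ((hg.1 x hx).of_le (by exact_mod_cast le_top))
  rw [this, mul_add]
  exact add_nonneg (hf.2 n x hx) (hg.2 n x hx)

theorem CompletelyMonotonicOn.const_mul {f : ℝ → ℝ} (hf : CompletelyMonotonicOn f (Ioi 0))
    {c : ℝ} (hc : 0 ≤ c) : CompletelyMonotonicOn (fun x => c * f x) (Ioi 0) := by
  refine ⟨contDiffOn_const.mul hf.1, fun n x hx => ?_⟩
  rw [iteratedDerivWithin_const_mul_field, mul_left_comm]
  exact mul_nonneg hc (hf.2 n x hx)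

theorem CompletelyMonotonicOn.mul {f g : ℝ → ℝ} (hf : CompletelyMonotonicOn f (Ioi 0))
    (hg : CompletelyMonotonicOn g (Ioi 0)) :
    CompletelyMonotonicOn (fun x => f x * g x) (Ioi 0) := by
  refine ⟨hf.1.mul hg.1, fun n x hx => ?_⟩
  have := iteratedDerivWithin_mul (n := n) hx (uniqueDiffOn_Ioi 0)
    ((hf.1 x hx).of_le (by exact_mod_cast le_top)) ((hg.1 x hx).of_le (by exact_mod_cast le_top))
  change 0 ≤ (-1 : ℝ) ^ n * iteratedDerivWithin n (f * g) (Ioi 0) x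
  rw [this, Finset.mul_sum]
  refine Finset.sum_nonneg fun i hi => ?_
  have hi : i ≤ n := Nat.lt_succ_iff.1 (Finset.mem_range.1 hi)
  have e : (-1 : ℝ) ^ n = (-1) ^ i * (-1) ^ (n - i) := by rw [← pow_add, Nat.add_sub_cancel' hi]
  have := mul_nonneg (Nat.cast_nonneg (α := ℝ) (n.choose i))
    (mul_nonneg (hf.2 i x hx) (hg.2 (n - i) x hx))
  rw [e]
  linarith

theorem CompletelyMonotonicOn.one : CompletelyMonotonicOn (fun _ => 1) (Ioi 0) := by
  refine ⟨contDiffOn_const, fun n x hx => ?_⟩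
  rw [iteratedDerivWithin_const]
  split_ifs with h <;> simp [h]

theorem CompletelyMonotonicOn.pow {f : ℝ → ℝ} (hf : CompletelyMonotonicOn f (Ioi 0)) (k : ℕ) :
    CompletelyMonotonicOn (fun x => f x ^ k) (Ioi 0) := by
  induction k with
  | zero => simpa using CompletelyMonotonicOn.one
  | succ k ih => simpa only [pow_succ] using ih.mul hf

theorem completelyMonotonicOn_inv_add {a : ℝ} (ha : 0 ≤ a) :
    CompletelyMonotonicOn (fun x => (x + a)⁻¹) (Ioi 0) := by
  have hne : ∀ x ∈ Ioi (0 : ℝ), x + a ≠ 0 := fun x hx => (add_pos_of_pos_of_nonneg hx ha).ne'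
  have hd : ∀ n : ℕ, ∀ x ∈ Ioi (0 : ℝ), iteratedDerivWithin n (fun x => (x + a)⁻¹) (Ioi 0) x =
      (-1) ^ n * n.factorial * ((x + a)⁻¹) ^ (n + 1) := by
    intro n
    induction n with
    | zero => simp
    | succ n ih =>
      intro x hx
      have h1 := (((((hasDerivAt_id' x).add_const a).fun_inv (hne x hx)).fun_pow
        (n + 1)).const_mul ((-1 : ℝ) ^ n * n.factorial))
      rw [iteratedDerivWithin_succ, derivWithin_of_isOpen isOpen_Ioi hx]
      refine (h1.congr_of_eventuallyEq ?_).deriv.trans ?_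
      · filter_upwards [Ioi_mem_nhds hx] with y hy using ih y hy
      · rw [Nat.factorial_succ, neg_div, one_div, ← inv_pow, Nat.add_sub_cancel]
        push_cast
        ring
  refine ⟨(contDiffOn_id.add contDiffOn_const).inv hne, fun n x hx => ?_⟩
  have hp : 0 < x + a := add_pos_of_pos_of_nonneg hx ha
  rw [hd n x hx, ← mul_assoc, ← mul_assoc, ← mul_pow]
  norm_num
  positivity

theorem completelyMonotonicOn_const_mul_inv_pow {c : ℝ} (hc : 0 ≤ c) (i j k l : ℕ) :
    CompletelyMonotonicOn (fun x => c * (x⁻¹ ^ i * (x + 1)⁻¹ ^ j * (x + 2)⁻¹ ^ k * (x + 3)⁻¹ ^ l))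
      (Ioi 0) := by
  have h0 := completelyMonotonicOn_inv_add (a := 0) le_rfl
  simp only [add_zero] at h0
  exact ((((h0.pow i).mul ((completelyMonotonicOn_inv_add zero_le_one).pow j)).mul
    ((completelyMonotonicOn_inv_add zero_le_two).pow k)).mul
    ((completelyMonotonicOn_inv_add zero_le_three).pow l)).const_mul hc

/-! ### The digamma function and its derivative -/

theorem Real.contDiffOn_Gamma_Ioi : ContDiffOn ℝ ∞ Real.Gamma (Ioi 0) := by
  intro x hx
  have hx : 0 < x := hx
  have hd : DifferentiableOn ℂ Complex.Gamma {z | 0 < z.re} := fun z hz =>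
    (Complex.differentiableAt_Gamma z fun m hm => by
      have hz : 0 < z.re := hz
      rw [hm] at hz
      simp only [Complex.neg_re, Complex.natCast_re] at hz
      linarith [Nat.cast_nonneg (α := ℝ) m]).differentiableWithinAt
  have ha : AnalyticAt ℂ Complex.Gamma (x : ℂ) := hd.analyticAt
    ((isOpen_lt continuous_const Complex.continuous_re).mem_nhds (by simpa using hx))
  exact (ContDiffAt.real_of_complex (n := ∞) ha.contDiffAt).contDiffWithinAt

theorem contDiffOn_psi : ContDiffOn ℝ ∞ psi (Ioi 0) :=
  (Real.contDiffOn_Gamma_Ioi.deriv_of_isOpen isOpen_Ioi (by simp)).div Real.contDiffOn_Gamma_Ioi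
    fun _ hx => (Real.Gamma_pos_of_pos hx).ne'

theorem contDiffOn_deriv_psi : ContDiffOn ℝ ∞ (deriv psi) (Ioi 0) :=
  contDiffOn_psi.deriv_of_isOpen isOpen_Ioi (by simp)

theorem hasDerivAt_psi {x : ℝ} (hx : 0 < x) : HasDerivAt psi (deriv psi x) x :=
  ((contDiffOn_psi.differentiableOn (by simp)).differentiableAt (Ioi_mem_nhds hx)).hasDerivAt

theorem psi_add_one {x : ℝ} (hx : 0 < x) : psi (x + 1) = psi x + x⁻¹ := by
  have hd : ∀ y, 0 < y → HasDerivAt Real.Gamma (deriv Real.Gamma y) y := fun y hy =>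
    (Real.differentiableOn_Gamma_Ioi.differentiableAt (Ioi_mem_nhds hy)).hasDerivAt
  have h1 := (hd (x + 1) (by linarith)).comp_add_const x 1
  have h2 := (hasDerivAt_id' x).mul (hd x hx)
  have h3 : deriv Real.Gamma (x + 1) = 1 * Real.Gamma x + x * deriv Real.Gamma x := by
    refine h1.unique (h2.congr_of_eventuallyEq ?_)
    filter_upwards [Ioi_mem_nhds hx] with y hy using Real.Gamma_add_one (ne_of_gt hy)
  have := Real.Gamma_pos_of_pos hx
  rw [psi, psi, h3, Real.Gamma_add_one hx.ne']
  field_simp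
  ring

theorem deriv_psi_sub_shift {x : ℝ} (hx : 0 < x) :
    deriv psi x - deriv psi (x + 1) = 1 / x ^ 2 := by
  have h1 := (hasDerivAt_psi (x := x + 1) (by linarith)).comp_add_const x 1
  have h2 := (hasDerivAt_psi hx).add (hasDerivAt_inv hx.ne')
  have := h1.unique (h2.congr_of_eventuallyEq (by
    filter_upwards [Ioi_mem_nhds hx] with y hy using psi_add_one hy))
  rw [this, one_div]
  ring

theorem monotoneOn_psi : MonotoneOn psi (Ioi 0) := by
  have hd : ∀ y, 0 < y → HasDerivAt (Real.log ∘ Real.Gamma) (psi y) y := fun y hy =>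
    (Real.differentiableOn_Gamma_Ioi.differentiableAt (Ioi_mem_nhds hy)).hasDerivAt.log
      (Real.Gamma_pos_of_pos hy).ne'
  refine (Real.convexOn_log_Gamma.monotoneOn_deriv fun x hx =>
    (hd x hx).differentiableAt).congr fun x hx => (hd x hx).deriv

theorem tendsto_const_add_natCast_atTop (x : ℝ) : Tendsto (fun n : ℕ => x + n) atTop atTop :=
  tendsto_atTop_add_const_left _ x tendsto_natCast_atTop_atTop

theorem tendsto_deriv_psi_add_nat {x : ℝ} (hx : 0 < x) :
    Tendsto (fun n : ℕ => deriv psi (x + n)) atTop (𝓝 0) := by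
  refine tendsto_add_nat_zero_of_antitoneOn_sub (H := fun x => -psi x)
    (fun y hy => (hasDerivAt_psi hy).neg) contDiffOn_deriv_psi.continuousOn ?_ ?_ x hx
  -- As δ ≤ 1, monotonicity and the functional equation put the increment of ψ between 0 and
  -- 1/(y+n).
  · intro y hy δ hδ hδ1
    have hinv : Tendsto (fun n : ℕ => -(y + n)⁻¹) atTop (𝓝 0) := by
      simpa using (tendsto_inv_atTop_zero.comp (tendsto_const_add_natCast_atTop y)).neg
    refine tendsto_of_tendsto_of_tendsto_of_le_of_le hinv tendsto_const_nhds ?_ ?_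
    · intro n
      have hn : (0 : ℝ) ≤ n := n.cast_nonneg
      have h1 := monotoneOn_psi (a := y + δ + n) (b := y + n + 1)
        (by simp only [mem_Ioi]; positivity) (by simp only [mem_Ioi]; positivity) (by linarith)
      rw [psi_add_one (by positivity)] at h1
      simp only
      linarith
    · intro n
      have hn : (0 : ℝ) ≤ n := n.cast_nonneg
      have h1 := monotoneOn_psi (a := y + n) (b := y + δ + n)
        (by simp only [mem_Ioi]; positivity) (by simp only [mem_Ioi]; positivity) (by linarith)
      simp only
      linarith
  · intro a ha b hb hab
    have ha : 0 < a := ha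
    simp only
    rw [deriv_psi_sub_shift ha, deriv_psi_sub_shift hb]
    gcongr

/-! ### Dependence on λ, decay and unit differences -/

theorem trigammaDiff_eq_sub (a lam x : ℝ) : trigammaDiff lam x = trigammaDiff a x -
    (lam - a) * ((4 + 8 * x + 5 * x ^ 2) / (24 * x * (1 + x) ^ 3 * (2 + x) ^ 2)) := by
  simp only [trigammaDiff]
  ring

theorem contDiffOn_trigammaDiff (lam : ℝ) : ContDiffOn ℝ ∞ (trigammaDiff lam) (Ioi 0) := by
  have h : ∀ x ∈ Ioi (0 : ℝ), x ≠ 0 ∧ 1 + x ≠ 0 ∧ 2 + x ≠ 0 := fun x hx => by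
    have hx : 0 < x := hx
    exact ⟨by positivity, by positivity, by positivity⟩
  refine (contDiffOn_deriv_psi.sub (ContDiffOn.div (by fun_prop) (by fun_prop) ?_)).sub
    (ContDiffOn.div (by fun_prop) (by fun_prop) ?_)
  all_goals
    intro x hx
    obtain ⟨h0, h1, h2⟩ := h x hx
    positivity

theorem tendsto_trigammaDiff_add_nat (lam : ℝ) {x : ℝ} (hx : 0 < x) :
    Tendsto (fun n : ℕ => trigammaDiff lam (x + n)) atTop (𝓝 0) := by
  have hinv : Tendsto (fun n : ℕ => (x + n)⁻¹) atTop (𝓝 0) :=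
    tendsto_inv_atTop_zero.comp (tendsto_const_add_natCast_atTop x)
  have hpos : ∀ n : ℕ, 0 < x + n := fun n => by positivity
  have hq : Tendsto (fun n : ℕ => (4 + 8 * (x + n) + 5 * (x + n) ^ 2) /
      (24 * (x + n) * (1 + (x + n)) ^ 3 * (2 + (x + n)) ^ 2)) atTop (𝓝 0) := by
    refine squeeze_zero (fun n => by positivity) (fun n => ?_) hinv
    have hy := hpos n
    generalize x + (n : ℝ) = y at hy
    -- With denominators cleared, the difference of the two sides expands with nonnegative
    -- coefficients.
    rw [inv_eq_one_div, div_le_div_iff₀ (by positivity) hy, ← sub_nonneg]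
    ring_nf
    positivity
  have hr : Tendsto (fun n : ℕ => (24 + 120 * (x + n) + 283 * (x + n) ^ 2 + 399 * (x + n) ^ 3
      + 345 * (x + n) ^ 4 + 181 * (x + n) ^ 5 + 51 * (x + n) ^ 6 + 6 * (x + n) ^ 7) /
      (6 * (x + n) ^ 2 * (1 + (x + n)) ^ 4 * (2 + (x + n)) ^ 2)) atTop (𝓝 0) := by
    refine squeeze_zero (fun n => by positivity) (fun n => ?_)
      (by simpa using hinv.add (hinv.pow 2))
    have hy := hpos n
    generalize x + (n : ℝ) = y at hy
    have e : y⁻¹ + (y ^ 2)⁻¹ = (y + 1) / y ^ 2 := by field_simp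
    rw [e, div_le_div_iff₀ (by positivity) (by positivity), ← sub_nonneg]
    ring_nf
    positivity
  simpa [trigammaDiff, mul_div_assoc] using
    ((tendsto_deriv_psi_add_nat hx).sub (hq.const_mul lam)).sub hr

theorem completelyMonotonicOn_weight : CompletelyMonotonicOn
    (fun x => (4 + 8 * x + 5 * x ^ 2) / (24 * x * (1 + x) ^ 3 * (2 + x) ^ 2)) (Ioi 0) := by
  -- 4 + 8x + 5x² = 4 + 3x + 5x(1 + x).
  refine (((completelyMonotonicOn_const_mul_inv_pow (c := 1 / 6) (by norm_num) 1 3 2 0).add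
    (completelyMonotonicOn_const_mul_inv_pow (c := 1 / 8) (by norm_num) 0 3 2 0)).add
    (completelyMonotonicOn_const_mul_inv_pow (c := 5 / 24) (by norm_num) 0 2 2 0)).congr ?_
  intro x hx
  field_simp
  ring

theorem trigammaDiff_sub_shift (lam : ℝ) {x : ℝ} (hx : 0 < x) :
    trigammaDiff lam x - trigammaDiff lam (x + 1) =
      ((4 - lam) * ((72 + 211 * x + 238 * x ^ 2 + 115 * x ^ 3 + 20 * x ^ 4) * (1 + x) * (2 + x))
        - (576 + 2244 * x + 3708 * x ^ 2 + 2944 * x ^ 3 + 1116 * x ^ 4 + 164 * x ^ 5)) /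
      (24 * x * (1 + x) ^ 4 * (2 + x) ^ 4 * (3 + x) ^ 2) := by
  have h := deriv_psi_sub_shift hx
  have h1 : deriv psi x = 1 / x ^ 2 + deriv psi (x + 1) := by linarith
  simp only [trigammaDiff]
  rw [h1]
  have e1 : 1 + (x + 1) = 2 + x := by ring
  have e2 : 2 + (x + 1) = 3 + x := by ring
  rw [e1, e2, show x + 1 = 1 + x by ring]
  field_simp
  ring

/-! ### The extreme cases λ = 0 and λ = 4 -/

theorem completelyMonotonicOn_trigammaDiff_zero :
    CompletelyMonotonicOn (trigammaDiff 0) (Ioi 0) := by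
  refine CompletelyMonotonicOn.of_sub_shift (contDiffOn_trigammaDiff 0)
    (fun x hx => tendsto_trigammaDiff_add_nat 0 hx) ?_
  -- At λ = 0 the constant term 4·72·2 - 576 vanishes, which cancels the pole at 0; hence no term
  -- contains x⁻¹.
  refine (((((((completelyMonotonicOn_const_mul_inv_pow (c := 7 / 6) (by norm_num) 0 0 4 3).add
    (completelyMonotonicOn_const_mul_inv_pow (c := 1) (by norm_num) 0 0 5 3)).add
    (completelyMonotonicOn_const_mul_inv_pow (c := 1 / 6) (by norm_num) 0 1 1 3)).add
    (completelyMonotonicOn_const_mul_inv_pow (c := 7 / 3) (by norm_num) 0 0 4 1)).add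
    (completelyMonotonicOn_const_mul_inv_pow (c := 1) (by norm_num) 0 3 5 2)).add
    (completelyMonotonicOn_const_mul_inv_pow (c := 4) (by norm_num) 0 4 3 3)).add
    (completelyMonotonicOn_const_mul_inv_pow (c := 5 / 6) (by norm_num) 0 0 3 2)).congr ?_
  intro x hx
  rw [trigammaDiff_sub_shift 0 hx]
  field_simp
  ring

theorem completelyMonotonicOn_neg_trigammaDiff_four :
    CompletelyMonotonicOn (fun x => -trigammaDiff 4 x) (Ioi 0) := by
  refine CompletelyMonotonicOn.of_sub_shift (contDiffOn_trigammaDiff 4).neg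
    (fun x hx => by simpa using (tendsto_trigammaDiff_add_nat 4 hx).neg) ?_
  -- With P the subtracted quintic in `trigammaDiff_sub_shift`, these are P(0) and the coefficients
  -- of (P(x) - P(0))/x in powers of 1 + x, all divided by 24.
  refine ((((((completelyMonotonicOn_const_mul_inv_pow (c := 24) (by norm_num) 1 4 4 2).add
    (completelyMonotonicOn_const_mul_inv_pow (c := 22) (by norm_num) 0 4 4 2)).add
    (completelyMonotonicOn_const_mul_inv_pow (c := 64 / 3) (by norm_num) 0 3 4 2)).add
    (completelyMonotonicOn_const_mul_inv_pow (c := 145 / 6) (by norm_num) 0 2 4 2)).add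
    (completelyMonotonicOn_const_mul_inv_pow (c := 115 / 6) (by norm_num) 0 1 4 2)).add
    (completelyMonotonicOn_const_mul_inv_pow (c := 41 / 6) (by norm_num) 0 0 4 2)).congr ?_
  intro x hx
  rw [neg_sub_neg, ← neg_sub, trigammaDiff_sub_shift 4 hx]
  field_simp
  ring

/-! ### Necessity of the bounds on λ -/

theorem trigammaDiff_zero_le {x : ℝ} (hx : 0 < x) : trigammaDiff 0 x ≤ 1 + trigammaDiff 0 1 := by
  have hanti : AntitoneOn (trigammaDiff 0) (Ioi 0) := by
    have hd : ∀ y, 0 < y → HasDerivAt (trigammaDiff 0)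
        (iteratedDerivWithin 1 (trigammaDiff 0) (Ioi 0) y) y := fun y hy => by
      simpa using hasDerivAt_iteratedDerivWithin_Ioi (contDiffOn_trigammaDiff 0) 0 hy
    refine antitoneOn_of_deriv_nonpos (convex_Ioi 0) (contDiffOn_trigammaDiff 0).continuousOn ?_ ?_
    · rw [interior_Ioi]
      exact (contDiffOn_trigammaDiff 0).differentiableOn (by simp)
    · rw [interior_Ioi]
      intro y hy
      rw [(hd y hy).deriv]
      linarith [completelyMonotonicOn_trigammaDiff_zero.2 1 y hy]
  have h1 : trigammaDiff 0 (x + 1) ≤ trigammaDiff 0 1 :=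
    hanti (by simp) (by simp only [mem_Ioi]; positivity) (by linarith)
  have h2 : trigammaDiff 0 x - trigammaDiff 0 (x + 1) ≤ 1 := by
    rw [trigammaDiff_sub_shift 0 hx, div_le_one (by positivity), ← sub_nonneg]
    ring_nf
    positivity
  linarith

theorem nonpos_of_trigammaDiff_nonneg {lam : ℝ} (h : ∀ x, 0 < x → 0 ≤ trigammaDiff lam x) :
    lam ≤ 0 := by
  by_contra! hl
  set C := 1 + |1 + trigammaDiff 0 1| with hC
  have hCpos : 0 < C := by positivity
  -- For x ≤ 1 the weight is at least 4/(24x·2³·3²) = 1/(432x), so λ times it is at least 2C, above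
  -- the bound on F_0.
  set x := min 1 (lam / (432 * (2 * C))) with hxdef
  have hx : 0 < x := by positivity
  have hx1 : x ≤ 1 := min_le_left _ _
  have hx2 : x * (432 * (2 * C)) ≤ lam := by
    rw [← le_div_iff₀ (by positivity)]; exact min_le_right _ _
  have h1 := h x hx
  rw [trigammaDiff_eq_sub 0] at h1
  have h2 := trigammaDiff_zero_le hx
  have h3 : 1 / (432 * x) ≤ (4 + 8 * x + 5 * x ^ 2) / (24 * x * (1 + x) ^ 3 * (2 + x) ^ 2) := by
    have e1 : (1 + x) ^ 3 ≤ 2 ^ 3 := by gcongr; linarith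
    have e2 : (2 + x) ^ 2 ≤ 3 ^ 2 := by gcongr; linarith
    calc 1 / (432 * x) = 4 / (24 * x * 2 ^ 3 * 3 ^ 2) := by field_simp; norm_num
      _ ≤ _ := by gcongr; nlinarith
  have h4 : 2 * C ≤ lam * (1 / (432 * x)) := by
    rw [mul_one_div, le_div_iff₀ (by positivity)]
    linarith
  have h5 := mul_le_mul_of_nonneg_left h3 hl.le
  have h6 := le_abs_self (1 + trigammaDiff 0 1)
  linarith

theorem four_le_of_trigammaDiff_nonpos {lam : ℝ} (h : ∀ x, 0 < x → trigammaDiff lam x ≤ 0) :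
    4 ≤ lam := by
  by_contra! hl
  have hl' : 0 < 4 - lam := by linarith
  -- 10752 is the coefficient sum of the subtracted quintic, which is thus at most 10752x⁵ for x ≥
  -- 1.
  set X := max 1 (10752 / (4 - lam)) with hX
  have hpos : ∀ x, X ≤ x → 0 < trigammaDiff lam x - trigammaDiff lam (x + 1) := by
    intro x hxX
    have hx1 : 1 ≤ x := (le_max_left _ _).trans hxX
    have hx : 0 < x := by linarith
    have hx2 : 10752 ≤ (4 - lam) * x := by
      rw [← div_le_iff₀' hl']; exact (le_max_right _ _).trans hxX
    rw [trigammaDiff_sub_shift lam hx]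
    refine div_pos ?_ (by positivity)
    have e1 : 20 * x ^ 6 <
        (72 + 211 * x + 238 * x ^ 2 + 115 * x ^ 3 + 20 * x ^ 4) * (1 + x) * (2 + x) := by
      rw [← sub_pos]; ring_nf; positivity
    have e2 : 576 + 2244 * x + 3708 * x ^ 2 + 2944 * x ^ 3 + 1116 * x ^ 4 + 164 * x ^ 5 ≤
        10752 * x ^ 5 := by
      have p0 := one_le_pow₀ hx1 (n := 5)
      have p1 := pow_le_pow_right₀ hx1 (show 1 ≤ 5 by norm_num)
      have p2 := pow_le_pow_right₀ hx1 (show 2 ≤ 5 by norm_num)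
      have p3 := pow_le_pow_right₀ hx1 (show 3 ≤ 5 by norm_num)
      have p4 := pow_le_pow_right₀ hx1 (show 4 ≤ 5 by norm_num)
      linarith
    have e3 := mul_lt_mul_of_pos_left e1 hl'
    have e4 := mul_le_mul_of_nonneg_right hx2 (show 0 ≤ x ^ 5 by positivity)
    have e5 : (4 - lam) * (20 * x ^ 6) = 20 * ((4 - lam) * x * x ^ 5) := by ring
    have e6 : 0 ≤ x ^ 5 := by positivity
    linarith
  have hX0 : 0 < X := by positivity
  -- Beyond X the values decrease along unit steps to 0, so F_λ(X) > F_λ(X+1) ≥ 0.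
  have h1 : 0 ≤ trigammaDiff lam (X + 1) :=
    nonneg_of_sub_shift_nonneg (tendsto_trigammaDiff_add_nat lam (by positivity))
      fun n => (hpos _ (by linarith [Nat.cast_nonneg (α := ℝ) n])).le
  linarith [hpos X le_rfl, h X hX0]

theorem mainTheorem2 (lam : ℝ) :
    (CompletelyMonotonicOn (trigammaDiff lam) (Set.Ioi 0) ↔ lam ≤ 0) ∧
    (CompletelyMonotonicOn (fun x => -trigammaDiff lam x) (Set.Ioi 0) ↔ 4 ≤ lam) := by
  refine ⟨⟨fun h => ?_, fun h => ?_⟩, ⟨fun h => ?_, fun h => ?_⟩⟩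
  · exact nonpos_of_trigammaDiff_nonneg fun x hx => by simpa using h.2 0 x hx
  · refine (completelyMonotonicOn_trigammaDiff_zero.add
      (completelyMonotonicOn_weight.const_mul (neg_nonneg.2 h))).congr fun x _ => ?_
    rw [trigammaDiff_eq_sub 0 lam]
    ring
  · exact four_le_of_trigammaDiff_nonpos fun x hx => by simpa using h.2 0 x hx
  · refine (completelyMonotonicOn_neg_trigammaDiff_four.add
      (completelyMonotonicOn_weight.const_mul (sub_nonneg.2 h))).congr fun x _ => ?_
    rw [trigammaDiff_eq_sub 4 lam]
    ring
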